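/- Let $G$ be a finite cyclic group with chosen generator $g$, and let $\underline{R}$ be a $G$-Tambara functor with restrictions $\mathrm{res}$, transfers $\mathrm{tr}$ and norms. The group $G$ acts on $\underline{R}$ by automorphisms of Green functors; on $\underline{R}(G/H)$ this is the action of the Weyl group $W_G(H)=G/H$. Let $$\underline{\mathbb W}_G(\underline{R})=\underline{\mathrm{HH}}{}^G_0(\underline{R})=\mathrm{coker}\big(d_0-d_1\colon {}^{g}\underline{R}\,\Box\,\underline{R}\to {}^{g}\underline{R}\big)$$ be the commutative Green functor of $G$-Witt vectors of $\underline{R}$, the zeroth homology of the $g$-twisted cyclic nerve; here $d_0$ is the right action $m\otimes n\mapsto mn$ and $d_1$ is the rotated and twisted left action $m\otimes n\mapsto (gn)m$. For a subgroup $H\subset G$ let $\underline{R}(G/H)_{W_G(H)}$ be the quotient of the ring $\underline{R}(G/H)$ by the ideal generated by all $wr-r$ with $w\in W_G(H)$ and $r\in\underline{R}(G/H)$, and let $$q\colon \underline{R}(G/H)_{W_G(H)}\to \underline{\mathbb W}_G(\underline{R})(G/H)$$ be the canonical surjective ring homomorphism. Let $N^{G/H}\underline{R}=N_H^G i_H^*\underline{R}$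 be the external norm, the left Kan extension of $i_H^*\underline{R}$ along the coinduction functor $F_H(G,-)$ on Burnside categories, let $N_H^G\colon\underline{R}(G/H)\to N^{G/H}\underline{R}(G/G)$ be its universal map, and let $n_H^G\colon N^{G/H}\underline{R}\to\underline{R}$ be the structure map of the Tambara functor $\underline{R}$. **Theorem.** For every subgroup $H\subset G$ there are maps of multiplicative monoids $$\underline{R}(G/H)\to \underline{R}(G/H)_{W_G(H)}\xrightarrow{\ t_{\underline{R}}\ } \underline{\mathbb W}_G(\underline{R})(G/G),$$ the first one being the quotient map, natural in the $G$-Tambara functor $\underline{R}$, whose composite is $$\underline{R}(G/H)\xrightarrow{N_H^G} N^{G/H}\underline{R}(G/G)\xrightarrow{n_H^G}\underline{R}(G/G)\to\underline{\mathbb W}_G(\underline{R})(G/G).$$ The composite lifts the $|G/H|$-th power map: for all $r\in\underline{R}(G/H)$, with class $[r]\in\underline{R}(G/H)_{W_G(H)}$, $$\mathrm{res}^G_H\big(t_{\underline{R}}([r])\big)=q\big([r]^{|G/H|}\big)\quad\text{in } \underline{\mathbb W}_G(\underline{R})(G/H).$$ -/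

import Mathlib

universe u w

/-! ### Finite `G`-sets -/

/-- A finite `G`-set. -/
structure FinGSet (G : Type u) [Group G] where
  carrier : Type u
  [finite : Finite carrier]
  [action : MulAction G carrier]

namespace FinGSet

instance {G : Type u} [Group G] : CoeSort (FinGSet G) (Type u) := ⟨FinGSet.carrier⟩

attribute [instance] FinGSet.finite FinGSet.action

section

variable {G : Type u} [Group G]

/-- The square `f ∘ p = k ∘ q` of finite `G`-sets is a pullback square. -/
def IsPullbackSquare {P X Y Z : FinGSet G} (p : P →[G] X) (q : P →[G] Y)
    (f : X →[G] Z) (k : Y →[G] Z) : Prop :=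
  (∀ a, f (p a) = k (q a)) ∧ ∀ x y, f x = k y → ∃! a, p a = x ∧ q a = y

/-- `Z` is the disjoint union of `X` and `Y` via `i` and `j`. -/
def IsDisjointUnion {X Y Z : FinGSet G} (i : X →[G] Z) (j : Y →[G] Z) : Prop :=
  Function.Bijective (Sum.elim i j : X ⊕ Y → Z)

/-- The diagram `X ⟵q A ⟵e E ⟶k P ⟶h Y` together with `l : E ⟶ X` is an exponential diagram over
`f : X ⟶ Y`: the map `h : P ⟶ Y` is the dependent product `Π_f A`, so that a point of `P` over `y`
is a section of `q` over the fibre `f ⁻¹ {y}`; `E = X ×_Y P`; and `e` is the evaluation map. -/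
def IsExponential {A X Y P E : FinGSet G} (q : A →[G] X) (f : X →[G] Y) (e : E →[G] A)
    (l : E →[G] X) (k : E →[G] P) (h : P →[G] Y) : Prop :=
  IsPullbackSquare l k f h ∧ (∀ c, q (e c) = l c) ∧
    ∀ (y : Y) (s : ∀ x : X, f x = y → A), (∀ x hx, q (s x hx) = x) →
      ∃! p : P, h p = y ∧ ∀ (c : E) (hc : f (l c) = y), k c = p → e c = s (l c) hc

/-- The orbit `G/H`. -/
def orbit [Finite G] (H : Subgroup G) : FinGSet G := ⟨G ⧸ H⟩

/-- The one-point `G`-set. -/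
def pt : FinGSet G := ⟨PUnit.{u + 1}⟩

/-- The product of two finite `G`-sets, with the diagonal action. -/
def prod (X Y : FinGSet G) : FinGSet G := ⟨X × Y⟩

/-- The projection `G/H ⟶ G/K` for `H ≤ K`. -/
def orbitMap [Finite G] {H K : Subgroup G} (h : H ≤ K) : orbit H →[G] orbit K where
  toFun := Quotient.map' id fun a b hab => by
    rw [QuotientGroup.leftRel_apply] at hab ⊢
    exact h hab
  map_smul' a x := by
    induction x using QuotientGroup.induction_on
    rfl

/-- A constant map to a point. -/
def toPt (X : FinGSet G) : X →[G] (pt : FinGSet G) where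
  toFun _ := PUnit.unit
  map_smul' _ _ := rfl

end

/-- For commutative `G`, the action of `a ∈ G` on a finite `G`-set is a map of `G`-sets. -/
def translate {G : Type u} [CommGroup G] (a : G) (X : FinGSet G) : X →[G] X where
  toFun x := a • x
  map_smul' b x := smul_comm a b x

end FinGSet

open FinGSet

/-! ### Mackey, Green and Tambara functors -/

/-- A Mackey functor for `G`: abelian groups `M(X)` for all finite `G`-sets `X`, with restrictions
and transfers along all maps of finite `G`-sets, which satisfy the base change formula and turn
disjoint unions into products. -/
structure MackeyFunctor (G : Type u) [Group G] where
  obj : FinGSet G → Type w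
  [addCommGroup : ∀ X, AddCommGroup (obj X)]
  res : ∀ {X Y : FinGSet G}, (X →[G] Y) → obj Y →+ obj X
  tr : ∀ {X Y : FinGSet G}, (X →[G] Y) → obj X →+ obj Y
  res_id : ∀ (X : FinGSet G) (m : obj X), res (MulActionHom.id G) m = m
  tr_id : ∀ (X : FinGSet G) (m : obj X), tr (MulActionHom.id G) m = m
  res_comp : ∀ {X Y Z : FinGSet G} (f : X →[G] Y) (k : Y →[G] Z) (m : obj Z),
    res (k.comp f) m = res f (res k m)
  tr_comp : ∀ {X Y Z : FinGSet G} (f : X →[G] Y) (k : Y →[G] Z) (m : obj X),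
    tr (k.comp f) m = tr k (tr f m)
  res_tr : ∀ {P X Y Z : FinGSet G} (p : P →[G] X) (q : P →[G] Y) (f : X →[G] Z) (k : Y →[G] Z),
    IsPullbackSquare p q f k → ∀ m : obj X, res k (tr f m) = tr q (res p m)
  empty : ∀ X : FinGSet G, IsEmpty X → Subsingleton (obj X)
  disjoint : ∀ {X Y Z : FinGSet G} (i : X →[G] Z) (j : Y →[G] Z), IsDisjointUnion i j →
    Function.Bijective fun m : obj Z => (res i m, res j m)

attribute [instance] MackeyFunctor.addCommGroup

/-- A commutative Green functor: a Mackey functor with values in commutative rings, whose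
restrictions are ring homomorphisms and whose transfers satisfy Frobenius reciprocity. -/
structure GreenFunctor (G : Type u) [Group G] where
  obj : FinGSet G → Type w
  [commRing : ∀ X, CommRing (obj X)]
  res : ∀ {X Y : FinGSet G}, (X →[G] Y) → obj Y →+* obj X
  tr : ∀ {X Y : FinGSet G}, (X →[G] Y) → obj X →+ obj Y
  res_id : ∀ (X : FinGSet G) (m : obj X), res (MulActionHom.id G) m = m
  tr_id : ∀ (X : FinGSet G) (m : obj X), tr (MulActionHom.id G) m = m
  res_comp : ∀ {X Y Z : FinGSet G} (f : X →[G] Y) (k : Y →[G] Z) (m : obj Z),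
    res (k.comp f) m = res f (res k m)
  tr_comp : ∀ {X Y Z : FinGSet G} (f : X →[G] Y) (k : Y →[G] Z) (m : obj X),
    tr (k.comp f) m = tr k (tr f m)
  res_tr : ∀ {P X Y Z : FinGSet G} (p : P →[G] X) (q : P →[G] Y) (f : X →[G] Z) (k : Y →[G] Z),
    IsPullbackSquare p q f k → ∀ m : obj X, res k (tr f m) = tr q (res p m)
  empty : ∀ X : FinGSet G, IsEmpty X → Subsingleton (obj X)
  disjoint : ∀ {X Y Z : FinGSet G} (i : X →[G] Z) (j : Y →[G] Z), IsDisjointUnion i j →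
    Function.Bijective fun m : obj Z => (res i m, res j m)
  frobenius : ∀ {X Y : FinGSet G} (f : X →[G] Y) (m : obj X) (n : obj Y),
    n * tr f m = tr f (res f n * m)

attribute [instance] GreenFunctor.commRing

/-- A Tambara functor: a commutative Green functor with multiplicative norms along all maps of
finite `G`-sets, which satisfy base change and the distributive law for norms of transfers. -/
structure TambaraFunctor (G : Type u) [Group G] extends GreenFunctor.{u, w} G where
  nm : ∀ {X Y : FinGSet G}, (X →[G] Y) → obj X →* obj Y
  nm_id : ∀ (X : FinGSet G) (m : obj X), nm (MulActionHom.id G) m = m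
  nm_comp : ∀ {X Y Z : FinGSet G} (f : X →[G] Y) (k : Y →[G] Z) (m : obj X),
    nm (k.comp f) m = nm k (nm f m)
  res_nm : ∀ {P X Y Z : FinGSet G} (p : P →[G] X) (q : P →[G] Y) (f : X →[G] Z) (k : Y →[G] Z),
    IsPullbackSquare p q f k → ∀ m : obj X, res k (nm f m) = nm q (res p m)
  nm_tr : ∀ {A X Y P E : FinGSet G} (q : A →[G] X) (f : X →[G] Y) (e : E →[G] A)
    (l : E →[G] X) (k : E →[G] P) (h : P →[G] Y), IsExponential q f e l k h →
    ∀ m : obj A, nm f (tr q m) = tr h (nm k (res e m))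

/-- A morphism of Tambara functors. -/
structure TambaraFunctor.Hom {G : Type u} [Group G] (R S : TambaraFunctor.{u, w} G) where
  app : ∀ X : FinGSet G, R.obj X →+* S.obj X
  app_res : ∀ {X Y : FinGSet G} (f : X →[G] Y) (m : R.obj Y),
    app X (R.res f m) = S.res f (app Y m)
  app_tr : ∀ {X Y : FinGSet G} (f : X →[G] Y) (m : R.obj X),
    app Y (R.tr f m) = S.tr f (app X m)
  app_nm : ∀ {X Y : FinGSet G} (f : X →[G] Y) (m : R.obj X),
    app Y (R.nm f m) = S.nm f (app X m)

namespace GreenFunctor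

/-- The underlying Mackey functor of a Green functor. -/
abbrev toMackey {G : Type u} [Group G] (R : GreenFunctor.{u, w} G) : MackeyFunctor.{u, w} G where
  obj := R.obj
  res f := (R.res f).toAddMonoidHom
  tr f := R.tr f
  res_id := R.res_id
  tr_id := R.tr_id
  res_comp := R.res_comp
  tr_comp := R.tr_comp
  res_tr := R.res_tr
  empty := R.empty
  disjoint := R.disjoint

theorem tr_res_of_bijective {G : Type u} [Group G] (R : GreenFunctor.{u, w} G) {U U' : FinGSet G} (θ : U' →[G] U) (hθ : Function.Bijective θ)
    (r : R.obj U) : R.tr θ (R.res θ r) = r := by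
  obtain ⟨θ', hθ'⟩ : ∃ θ' : U →[G] U', ∀ c, θ (θ' c) = c := by
    refine ⟨⟨fun c => Classical.choose (hθ.2 c), fun b c => hθ.1 ?_⟩, fun c => ?_⟩
    · simp only [map_smul, Classical.choose_spec (hθ.2 _)]
      rfl
    · exact Classical.choose_spec (hθ.2 c)
  have hsq : IsPullbackSquare (MulActionHom.id G) (MulActionHom.id G) θ θ :=
    ⟨fun _ => rfl, fun c d hcd => ⟨c, ⟨rfl, hθ.1 hcd⟩, fun e he => he.1⟩⟩
  have h3 := congrArg (R.res θ') (R.res_tr _ _ _ _ hsq (R.res θ r))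
  rw [R.res_id, R.tr_id, ← R.res_comp, ← R.res_comp] at h3
  have h4 : θ.comp θ' = MulActionHom.id G := by
    ext c
    exact hθ' c
  rwa [h4, R.res_id, R.res_id] at h3

end GreenFunctor

/-! ### The box product

`M □ N` is the Day convolution product: the left Kan extension of
`(Y, Z) ↦ M(Y) × N(Z)` (with values in sets) along the cartesian product of finite `G`-sets on
Burnside categories. Below is the pointwise (coend) formula for it. -/

namespace MackeyFunctor

variable {G : Type u} [Group G]

/-- A representative of an element of `(M □ N)(X)`: a span `Y × Z ⟵ U ⟶ X`, an element of `M(Y)`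
and an element of `N(Z)`. -/
structure BoxRep (M N : MackeyFunctor.{u, w} G) (X : FinGSet G) where
  {Y Z U : FinGSet G}
  y : U →[G] Y
  z : U →[G] Z
  x : U →[G] X
  m : M.obj Y
  n : N.obj Z

/-- The relations of the coend: isomorphic spans are identified, and restrictions and transfers in
either variable may be moved to the span. -/
inductive BoxRel (M N : MackeyFunctor.{u, w} G) (X : FinGSet G) :
    BoxRep M N X → BoxRep M N X → Prop
  | iso {Y Z U U' : FinGSet G} (θ : U' →[G] U) (_ : Function.Bijective θ)
      (y : U →[G] Y) (z : U →[G] Z) (x : U →[G] X) (m : M.obj Y) (n : N.obj Z) :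
      BoxRel M N X ⟨y, z, x, m, n⟩ ⟨y.comp θ, z.comp θ, x.comp θ, m, n⟩
  | res_left {Y Y' Z U : FinGSet G} (f : Y →[G] Y')
      (y : U →[G] Y) (z : U →[G] Z) (x : U →[G] X) (m : M.obj Y') (n : N.obj Z) :
      BoxRel M N X ⟨y, z, x, M.res f m, n⟩ ⟨f.comp y, z, x, m, n⟩
  | res_right {Y Z Z' U : FinGSet G} (f : Z →[G] Z')
      (y : U →[G] Y) (z : U →[G] Z) (x : U →[G] X) (m : M.obj Y) (n : N.obj Z') :
      BoxRel M N X ⟨y, z, x, m, N.res f n⟩ ⟨y, f.comp z, x, m, n⟩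
  | tr_left {Y Y' Z U V : FinGSet G} (f : Y →[G] Y')
      (y : U →[G] Y') (z : U →[G] Z) (x : U →[G] X) (v : V →[G] Y) (p : V →[G] U)
      (_ : IsPullbackSquare v p f y) (m : M.obj Y) (n : N.obj Z) :
      BoxRel M N X ⟨y, z, x, M.tr f m, n⟩ ⟨v, z.comp p, x.comp p, m, n⟩
  | tr_right {Y Z Z' U V : FinGSet G} (f : Z →[G] Z')
      (y : U →[G] Y) (z : U →[G] Z') (x : U →[G] X) (v : V →[G] Z) (p : V →[G] U)
      (_ : IsPullbackSquare v p f z) (m : M.obj Y) (n : N.obj Z) :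
      BoxRel M N X ⟨y, z, x, m, N.tr f n⟩ ⟨y.comp p, v, x.comp p, m, n⟩

/-- The value `(M □ N)(X)` of the box product. -/
def Box (M N : MackeyFunctor.{u, w} G) (X : FinGSet G) : Type max (u + 1) w :=
  Quot (BoxRel M N X)

end MackeyFunctor

/-! ### Zeroth twisted Hochschild homology and Witt vectors -/

namespace GreenFunctor

variable {G : Type u} [CommGroup G] (R : GreenFunctor.{u, w} G)

/-- The action of `a ∈ G` on `R(X)`. On `R(G/H)` it is the action of the Weyl group, which is
`G/H` since `G` is commutative. -/
def act (a : G) (X : FinGSet G) : R.obj X →+* R.obj X := R.res (translate a X)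

theorem act_res (a : G) {X Y : FinGSet G} (f : X →[G] Y) (m : R.obj Y) :
    R.act a X (R.res f m) = R.res f (R.act a Y m) := by
  simp only [act, ← R.res_comp]
  congr 2
  ext x
  exact map_smul f a x

theorem isPullbackSquare_translate (a : G) {X Y : FinGSet G} (f : X →[G] Y) :
    IsPullbackSquare (translate a X) f f (translate a Y) := by
  refine ⟨fun x => map_smul f a x, fun x y h => ⟨a⁻¹ • x, ⟨?_, ?_⟩, ?_⟩⟩
  · exact smul_inv_smul a x
  · rw [map_smul, h]
    exact inv_smul_smul a y
  · rintro b ⟨hb, -⟩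
    rw [← hb]
    exact (inv_smul_smul a b).symm

theorem act_tr (a : G) {X Y : FinGSet G} (f : X →[G] Y) (m : R.obj X) :
    R.act a Y (R.tr f m) = R.tr f (R.act a X m) :=
  R.res_tr _ _ _ _ (isPullbackSquare_translate a f) m

/-- A face map of the twisted cyclic nerve in simplicial degree one, given on the generator of
`(R □ R)(X)` with span `Y × Z ⟵ U ⟶ X` and elements `m`, `n` by the external product of `m` and
`a n`, followed by the map induced by the span. -/
def face (a : G) (X : FinGSet G) : R.toMackey.Box R.toMackey X → R.obj X :=
  Quot.lift (fun b => R.tr b.x (R.res b.y b.m * R.res b.z (R.act a b.Z b.n))) (by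
    intro b b' h
    induction h with
    | @iso Y Z U U' θ hθ y z x m n =>
      change R.tr x (R.res y m * R.res z (R.act a Z n)) =
        R.tr (x.comp θ) (R.res (y.comp θ) m * R.res (z.comp θ) (R.act a Z n))
      rw [R.tr_comp, R.res_comp, R.res_comp, ← map_mul, R.tr_res_of_bijective θ hθ]
    | @res_left Y Y' Z U f y z x m n =>
      change R.tr x (R.res y (R.res f m) * R.res z (R.act a Z n)) =
        R.tr x (R.res (f.comp y) m * R.res z (R.act a Z n))
      rw [R.res_comp]
    | @res_right Y Z Z' U f y z x m n =>
      change R.tr x (R.res y m * R.res z (R.act a Z (R.res f n))) =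
        R.tr x (R.res y m * R.res (f.comp z) (R.act a Z' n))
      rw [R.res_comp, R.act_res]
    | @tr_left Y Y' Z U V f y z x v p hsq m n =>
      change R.tr x (R.res y (R.tr f m) * R.res z (R.act a Z n)) =
        R.tr (x.comp p) (R.res v m * R.res (z.comp p) (R.act a Z n))
      rw [R.tr_comp, R.res_comp, R.res_tr _ _ _ _ hsq, mul_comm, R.frobenius, mul_comm]
    | @tr_right Y Z Z' U V f y z x v p hsq m n =>
      change R.tr x (R.res y m * R.res z (R.act a Z' (R.tr f n))) =
        R.tr (x.comp p) (R.res (y.comp p) m * R.res v (R.act a Z n))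
      rw [R.tr_comp, R.res_comp, R.act_tr, R.res_tr _ _ _ _ hsq, R.frobenius])

/-- The twisted cyclic nerve of `R` with coefficients in `R` with left module structure twisted by
`g` has `R` in degree zero and `R □ R` in degree one. The face `d₀` is the right action
`m ⊗ n ↦ m n`. -/
def dZero (X : FinGSet G) : R.toMackey.Box R.toMackey X → R.obj X := R.face 1 X

/-- The face `d₁` rotates the last factor to the front and then applies the `g`-twisted left
action, `m ⊗ n ↦ (g n) m`. -/
def dOne (g : G) (X : FinGSet G) : R.toMackey.Box R.toMackey X → R.obj X := R.face g X

theorem act_one (X : FinGSet G) (r : R.obj X) : R.act 1 X r = r := by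
  have h : translate (1 : G) X = MulActionHom.id G := by
    ext x
    exact one_smul G x
  rw [act, h, R.res_id]

/-- The image of `d₀ - d₁` in `R(X)`. -/
def boundary (g : G) (X : FinGSet G) : AddSubgroup (R.obj X) :=
  AddSubgroup.closure (Set.range fun b => R.dZero X b - R.dOne g X b)

theorem mem_boundary (g : G) {U X : FinGSet G} (x : U →[G] X) (m n : R.obj U) :
    R.tr x (m * (n - R.act g U n)) ∈ R.boundary g X := by
  refine AddSubgroup.subset_closure
    ⟨Quot.mk _ ⟨MulActionHom.id G, MulActionHom.id G, x, m, n⟩, ?_⟩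
  change R.tr x (R.res _ m * R.res _ (R.act 1 U n)) - R.tr x (R.res _ m * R.res _ (R.act g U n)) = _
  rw [R.act_one, R.res_id, R.res_id, R.res_id, ← map_sub, mul_sub]

theorem boundary_induction (g : G) {X : FinGSet G} {A : Type*} [AddGroup A] (φ : R.obj X →+ A)
    (B : AddSubgroup A)
    (h : ∀ {U : FinGSet G} (x : U →[G] X) (m n : R.obj U),
      φ (R.tr x (m * (n - R.act g U n))) ∈ B) {r : R.obj X} (hr : r ∈ R.boundary g X) :
    φ r ∈ B := by
  suffices R.boundary g X ≤ B.comap φ from this hr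
  refine (AddSubgroup.closure_le _).2 ?_
  rintro _ ⟨b, rfl⟩
  induction b using Quot.ind with
  | mk b =>
    have := h b.x (R.res b.y b.m) (R.res b.z b.n)
    rw [R.act_res, mul_sub, map_sub (R.tr b.x)] at this
    change φ (R.tr b.x (R.res b.y b.m * R.res b.z (R.act 1 _ b.n)) -
      R.tr b.x (R.res b.y b.m * R.res b.z (R.act g _ b.n))) ∈ B
    rwa [R.act_one]

/-- The image of `d₀ - d₁` is an ideal. -/
def boundaryIdeal (g : G) (X : FinGSet G) : Ideal (R.obj X) where
  __ := R.boundary g X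
  smul_mem' c r hr := by
    refine R.boundary_induction g (AddMonoidHom.mulLeft c) (R.boundary g X) ?_ hr
    intro U x m n
    have := R.mem_boundary g x (R.res x c * m) n
    rwa [mul_assoc, ← R.frobenius] at this

theorem mem_boundaryIdeal (g : G) {U X : FinGSet G} (x : U →[G] X) (m n : R.obj U) :
    R.tr x (m * (n - R.act g U n)) ∈ R.boundaryIdeal g X :=
  R.mem_boundary g x m n

theorem boundaryIdeal_tr (g : G) {X Y : FinGSet G} (f : X →[G] Y) {r : R.obj X}
    (hr : r ∈ R.boundaryIdeal g X) : R.tr f r ∈ R.boundaryIdeal g Y := by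
  refine R.boundary_induction g (R.tr f) (R.boundary g Y) ?_ hr
  intro U x m n
  rw [← R.tr_comp]
  exact R.mem_boundary g _ m n

end GreenFunctor

namespace FinGSet

variable {G : Type u} [Group G]

/-- The pullback of finite `G`-sets. -/
def pullback {X Y Z : FinGSet G} (f : X →[G] Z) (k : Y →[G] Z) : FinGSet G :=
  letI : MulAction G {a : X × Y // f a.1 = k a.2} :=
    { smul := fun g a => ⟨g • a.1, by
        change f (g • a.1.1) = k (g • a.1.2)
        rw [map_smul, map_smul, a.2]⟩
      one_smul := fun a => Subtype.ext (one_smul G a.1)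
      mul_smul := fun g h a => Subtype.ext (mul_smul g h a.1) }
  ⟨{a : X × Y // f a.1 = k a.2}⟩

def pullbackFst {X Y Z : FinGSet G} (f : X →[G] Z) (k : Y →[G] Z) : pullback f k →[G] X where
  toFun a := a.1.1
  map_smul' _ _ := rfl

def pullbackSnd {X Y Z : FinGSet G} (f : X →[G] Z) (k : Y →[G] Z) : pullback f k →[G] Y where
  toFun a := a.1.2
  map_smul' _ _ := rfl

theorem isPullbackSquare_pullback {X Y Z : FinGSet G} (f : X →[G] Z) (k : Y →[G] Z) :
    IsPullbackSquare (pullbackFst f k) (pullbackSnd f k) f k :=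
  ⟨fun a => a.2, fun x y h => ⟨⟨(x, y), h⟩, ⟨rfl, rfl⟩, fun _ hb =>
    Subtype.ext (Prod.ext hb.1 hb.2)⟩⟩

end FinGSet

namespace GreenFunctor

variable {G : Type u} [CommGroup G] (R : GreenFunctor.{u, w} G)

theorem boundaryIdeal_res (g : G) {X Y : FinGSet G} (f : X →[G] Y) {r : R.obj Y}
    (hr : r ∈ R.boundaryIdeal g Y) : R.res f r ∈ R.boundaryIdeal g X := by
  refine R.boundary_induction g (R.res f).toAddMonoidHom (R.boundary g X) ?_ hr
  intro U x m n
  change R.res f (R.tr x _) ∈ _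
  rw [R.res_tr _ _ _ _ (isPullbackSquare_pullback x f), map_mul, map_sub, ← R.act_res]
  exact R.mem_boundary g _ _ _

/-- The zeroth twisted Hochschild homology of `R`, that is, the cokernel of
`d₀ - d₁ : R □ R ⟶ R`, as a commutative Green functor. With `g` the chosen generator of the finite
cyclic group `G`, this is the Green functor `W_G(R)` of `G`-Witt vectors of `R`. -/
def witt (g : G) : GreenFunctor.{u, w} G where
  obj X := R.obj X ⧸ R.boundaryIdeal g X
  res {X Y} f := Ideal.quotientMap (R.boundaryIdeal g X) (R.res f)
    fun _ hr => R.boundaryIdeal_res g f hr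
  tr {X Y} f := QuotientAddGroup.map (R.boundaryIdeal g X).toAddSubgroup
    (R.boundaryIdeal g Y).toAddSubgroup (R.tr f) fun _ hr => R.boundaryIdeal_tr g f hr
  res_id X m := by
    obtain ⟨m, rfl⟩ := Ideal.Quotient.mk_surjective m
    exact congrArg _ (R.res_id X m)
  tr_id X m := by
    obtain ⟨m, rfl⟩ := Ideal.Quotient.mk_surjective m
    exact congrArg _ (R.tr_id X m)
  res_comp f k m := by
    obtain ⟨m, rfl⟩ := Ideal.Quotient.mk_surjective m
    exact congrArg _ (R.res_comp f k m)
  tr_comp f k m := by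
    obtain ⟨m, rfl⟩ := Ideal.Quotient.mk_surjective m
    exact congrArg _ (R.tr_comp f k m)
  res_tr p q f k h m := by
    obtain ⟨m, rfl⟩ := Ideal.Quotient.mk_surjective m
    exact congrArg _ (R.res_tr p q f k h m)
  empty X hX := by
    have := R.empty X hX
    exact Ideal.Quotient.mk_surjective.subsingleton
  disjoint {X Y Z} i j h := by
    have hi : ∀ r : R.obj X, R.res i (R.tr i r) = r := fun r => by
      rw [R.res_tr (MulActionHom.id G) (MulActionHom.id G) i i ⟨fun _ => rfl, fun c d hcd =>
        ⟨c, ⟨rfl, Sum.inl_injective (h.1 (a₁ := Sum.inl c) (a₂ := Sum.inl d) hcd)⟩,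
          fun e he => he.1⟩⟩, R.res_id, R.tr_id]
    have hj : ∀ r : R.obj Y, R.res j (R.tr j r) = r := fun r => by
      rw [R.res_tr (MulActionHom.id G) (MulActionHom.id G) j j ⟨fun _ => rfl, fun c d hcd =>
        ⟨c, ⟨rfl, Sum.inr_injective (h.1 (a₁ := Sum.inr c) (a₂ := Sum.inr d) hcd)⟩,
          fun e he => he.1⟩⟩, R.res_id, R.tr_id]
    have hij : ∀ r : R.obj Y, R.res i (R.tr j r) = 0 := fun r => by
      have hE : IsEmpty (pullback j i) := ⟨fun a => Sum.inr_ne_inl (h.1 (a₁ := Sum.inr a.1.1)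
        (a₂ := Sum.inl a.1.2) a.2)⟩
      have := R.empty _ hE
      rw [R.res_tr _ _ _ _ (isPullbackSquare_pullback j i),
        Subsingleton.elim (R.res _ r) 0, map_zero]
    have hji : ∀ r : R.obj X, R.res j (R.tr i r) = 0 := fun r => by
      have hE : IsEmpty (pullback i j) := ⟨fun a => Sum.inl_ne_inr (h.1 (a₁ := Sum.inl a.1.1)
        (a₂ := Sum.inr a.1.2) a.2)⟩
      have := R.empty _ hE
      rw [R.res_tr _ _ _ _ (isPullbackSquare_pullback i j),
        Subsingleton.elim (R.res _ r) 0, map_zero]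
    have hsum : ∀ r : R.obj Z, r = R.tr i (R.res i r) + R.tr j (R.res j r) := fun r =>
      (R.disjoint i j h).1 (Prod.ext
        (by simp only [map_add, hi, hij, add_zero]) (by simp only [map_add, hj, hji, zero_add]))
    constructor
    · intro a b hab
      obtain ⟨a, rfl⟩ := Ideal.Quotient.mk_surjective a
      obtain ⟨b, rfl⟩ := Ideal.Quotient.mk_surjective b
      have h1 : R.res i a - R.res i b ∈ R.boundaryIdeal g X :=
        Ideal.Quotient.eq.1 (congrArg Prod.fst hab)
      have h2 : R.res j a - R.res j b ∈ R.boundaryIdeal g Y :=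
        Ideal.Quotient.eq.1 (congrArg Prod.snd hab)
      refine Ideal.Quotient.eq.2 ?_
      rw [hsum (a - b), map_sub (R.res i), map_sub (R.res j)]
      exact add_mem (R.boundaryIdeal_tr g i h1) (R.boundaryIdeal_tr g j h2)
    · rintro ⟨a, b⟩
      obtain ⟨a, rfl⟩ := Ideal.Quotient.mk_surjective a
      obtain ⟨b, rfl⟩ := Ideal.Quotient.mk_surjective b
      refine ⟨Ideal.Quotient.mk _ (R.tr i a + R.tr j b), Prod.ext ?_ ?_⟩
      · exact congrArg (Ideal.Quotient.mk (R.boundaryIdeal g X)) (show R.res i (R.tr i a + R.tr j b) = a by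
          rw [map_add, hi, hij, add_zero])
      · exact congrArg (Ideal.Quotient.mk (R.boundaryIdeal g Y)) (show R.res j (R.tr i a + R.tr j b) = b by
          rw [map_add, hj, hji, zero_add])
  frobenius f m n := by
    obtain ⟨m, rfl⟩ := Ideal.Quotient.mk_surjective m
    obtain ⟨n, rfl⟩ := Ideal.Quotient.mk_surjective n
    exact congrArg _ (R.frobenius f m n)

/-- The canonical quotient map `R(X) ⟶ W_G(R)(X)`. -/
def toWitt (g : G) (X : FinGSet G) : R.obj X →+* (R.witt g).obj X :=
  Ideal.Quotient.mk (R.boundaryIdeal g X)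

/-- The ideal of `R(G/H)` generated by all differences `a r - r`, whose quotient is the ring of Weyl
coinvariants. Since `G` is commutative, `W_G(H) = G/H`, acting through
the action of `G`. -/
def coinvariantsIdeal [Finite G] (H : Subgroup G) : Ideal (R.obj (orbit H)) :=
  Ideal.span {s | ∃ (a : G) (r : R.obj (orbit H)), s = R.act a _ r - r}

/-- The ring of Weyl coinvariants `R(G/H)_{W_G(H)}`. -/
abbrev Coinvariants [Finite G] (H : Subgroup G) : Type w :=
  R.obj (orbit H) ⧸ R.coinvariantsIdeal H

/-- The quotient map `R(G/H) ⟶ R(G/H)_{W_G(H)}`. -/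
def toCoinvariants [Finite G] (H : Subgroup G) : R.obj (orbit H) →+* R.Coinvariants H :=
  Ideal.Quotient.mk _

theorem coinvariantsIdeal_le [Finite G] (g : G) (hg : ∀ a : G, a ∈ Subgroup.zpowers g)
    (H : Subgroup G) : R.coinvariantsIdeal H ≤ R.boundaryIdeal g (orbit H) := by
  refine Ideal.span_le.2 ?_
  rintro _ ⟨a, r, rfl⟩
  have hmem : ∀ s : R.obj (orbit H), s - R.act g _ s ∈ R.boundaryIdeal g (orbit H) := fun s => by
    have := R.mem_boundaryIdeal g (MulActionHom.id G) 1 s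
    rwa [R.tr_id, one_mul] at this
  have hmul : ∀ (b c : G) (s : R.obj (orbit H)),
      R.act (b * c) _ s = R.act c _ (R.act b _ s) := fun b c s => by
    rw [act, act, act, ← R.res_comp]
    congr 2
    ext x
    exact mul_smul b c x
  have hpow : ∀ (k : ℕ) (s : R.obj (orbit H)),
      R.act (g ^ k) _ s - s ∈ R.boundaryIdeal g (orbit H) := by
    intro k
    induction k with
    | zero => intro s; simp [R.act_one]
    | succ k ih =>
      intro s
      rw [pow_succ, hmul, ← sub_add_sub_cancel _ (R.act (g ^ k) _ s) s]
      refine add_mem ?_ (ih s)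
      rw [← neg_sub]
      exact neg_mem (hmem _)
  obtain ⟨k, rfl⟩ := (mem_powers_iff_mem_zpowers (x := g)).2 (hg a)
  exact hpow k r

/-- The canonical surjection `R(G/H)_{W_G(H)} ⟶ W_G(R)(G/H)`. -/
def coinvariantsToWitt [Finite G] (g : G) (hg : ∀ a : G, a ∈ Subgroup.zpowers g)
    (H : Subgroup G) : R.Coinvariants H →+* (R.witt g).obj (orbit H) :=
  Ideal.Quotient.factor (R.coinvariantsIdeal_le g hg H)

end GreenFunctor

/-! ### Functoriality in the Tambara functor -/

namespace TambaraFunctor.Hom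

variable {G : Type u} [CommGroup G] {R S : TambaraFunctor.{u, w} G} (φ : Hom R S)

/-- The map on Weyl coinvariants induced by a morphism of Tambara functors. -/
def mapCoinvariants [Finite G] (H : Subgroup G) : R.Coinvariants H →+* S.Coinvariants H :=
  Ideal.quotientMap _ (φ.app (orbit H)) (by
    refine Ideal.span_le.2 ?_
    rintro _ ⟨a, r, rfl⟩
    refine Ideal.subset_span ⟨a, φ.app _ r, ?_⟩
    rw [map_sub, GreenFunctor.act, φ.app_res]
    rfl)

/-- The map on Witt vectors induced by a morphism of Tambara functors. -/
def mapWitt (g : G) (X : FinGSet G) : (R.witt g).obj X →+* (S.witt g).obj X :=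
  Ideal.quotientMap (S.boundaryIdeal g X) (φ.app X) (by
    intro r hr
    refine R.boundary_induction g (φ.app X).toAddMonoidHom (S.boundary g X) ?_ hr
    intro U x m n
    change φ.app X _ ∈ _
    rw [φ.app_tr, map_mul, map_sub, GreenFunctor.act, φ.app_res]
    exact S.mem_boundary g _ _ _)

end TambaraFunctor.Hom

/-! ### Induction, coinduction and restriction -/

namespace FinGSet

variable {G : Type u} [Group G] [Finite G] (H : Subgroup G)

/-- The coinduced `G`-set `F_H(G, T)` of all maps `φ : G ⟶ T` with `φ (h a) = h φ(a)`, with action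
`(b φ)(a) = φ (a b)`. -/
def coind (T : FinGSet H) : FinGSet G :=
  letI : MulAction G {φ : G → T // ∀ (h : H) (a : G), φ (h * a) = h • φ a} :=
    { smul := fun b φ => ⟨fun a => φ.1 (a * b), fun h a =>
        (congrArg φ.1 (mul_assoc (h : G) a b)).trans (φ.2 h (a * b))⟩
      one_smul := fun φ => Subtype.ext (funext fun a => congrArg φ.1 (mul_one a))
      mul_smul := fun b c φ => Subtype.ext (funext fun a => congrArg φ.1 (mul_assoc a b c).symm) }
  ⟨{φ : G → T // ∀ (h : H) (a : G), φ (h * a) = h • φ a}⟩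

/-- Functoriality of coinduction. -/
def coindMap {T T' : FinGSet H} (f : T →[H] T') : coind H T →[G] coind H T' where
  toFun φ := ⟨fun a => f (φ.1 a), fun h a =>
    (congrArg f (φ.2 h a)).trans (map_smul f h (φ.1 a))⟩
  map_smul' _ _ := rfl

/-- The relation `(a h, t) ∼ (a, h t)` on `G × T`. -/
def indSetoid (T : FinGSet H) : Setoid (G × T) where
  r p q := ∃ h : H, q.1 * h = p.1 ∧ h • p.2 = q.2
  iseqv :=
    { refl := fun p => ⟨1, by simp, by simp⟩
      symm := by
        rintro p q ⟨h, h1, h2⟩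
        exact ⟨h⁻¹, by simp [← h1], by rw [← h2, inv_smul_smul]⟩
      trans := by
        rintro p q r ⟨h, h1, h2⟩ ⟨k, k1, k2⟩
        exact ⟨k * h, by rw [← h1, ← k1, Subgroup.coe_mul, mul_assoc], by
          rw [mul_smul, h2, k2]⟩ }

/-- The induced `G`-set `G ×_H T`. -/
def ind (T : FinGSet H) : FinGSet G :=
  letI : MulAction G (Quotient (indSetoid H T)) :=
    { smul := fun b => Quotient.map (fun p => (b * p.1, p.2)) (by
        rintro p q ⟨h, h1, h2⟩
        exact ⟨h, by rw [← h1, mul_assoc], h2⟩)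
      one_smul := by
        rintro ⟨a, t⟩
        exact congrArg (Quotient.mk _) (Prod.ext (one_mul a) rfl)
      mul_smul := by
        rintro b c ⟨a, t⟩
        exact congrArg (Quotient.mk _) (Prod.ext (mul_assoc b c a) rfl) }
  ⟨Quotient (indSetoid H T)⟩

/-- The class of `(a, t)` in `G ×_H T`. -/
def indMk {T : FinGSet H} (a : G) (t : T) : ind H T := Quotient.mk (indSetoid H T) (a, t)

/-- Functoriality of induction. -/
def indMap {T T' : FinGSet H} (f : T →[H] T') : ind H T →[G] ind H T' where
  toFun := Quotient.map (fun p => (p.1, f p.2)) (by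
    rintro p q ⟨h, h1, h2⟩
    exact ⟨h, h1, by rw [← h2, map_smul]⟩)
  map_smul' b := by
    rintro ⟨a, t⟩
    rfl

theorem indMk_eq {T : FinGSet H} {a b : G} {t s : T} :
    indMk H a t = indMk H b s ↔ ∃ h : H, b * h = a ∧ h • t = s :=
  Quotient.eq (r := indSetoid H T)

theorem indMk_surjective {T : FinGSet H} (x : ind H T) : ∃ a t, indMk H a t = x := by
  obtain ⟨⟨a, t⟩, h⟩ := Quotient.exists_rep (s := indSetoid H T) x
  exact ⟨a, t, h⟩

theorem indMap_mk {T T' : FinGSet H} (f : T →[H] T') (a : G) (t : T) :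
    indMap H f (indMk H a t) = indMk H a (f t) := rfl

theorem isPullbackSquare_ind {P X Y Z : FinGSet H} {p : P →[H] X} {q : P →[H] Y}
    {f : X →[H] Z} {k : Y →[H] Z} (h : IsPullbackSquare p q f k) :
    IsPullbackSquare (indMap H p) (indMap H q) (indMap H f) (indMap H k) := by
  refine ⟨fun c => ?_, fun c d hcd => ?_⟩
  · obtain ⟨a, t, rfl⟩ := indMk_surjective H c
    simp only [indMap_mk, h.1]
  · obtain ⟨a, x, rfl⟩ := indMk_surjective H c
    obtain ⟨b, y, rfl⟩ := indMk_surjective H d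
    rw [indMap_mk, indMap_mk, indMk_eq] at hcd
    obtain ⟨s, hs, hxy⟩ := hcd
    rw [← map_smul] at hxy
    obtain ⟨e, ⟨he1, he2⟩, hu⟩ := h.2 _ _ hxy
    refine ⟨indMk H b e, ⟨?_, ?_⟩, ?_⟩
    · simp only [indMap_mk, he1]
      exact (indMk_eq H).2 ⟨s⁻¹, by simp [← hs], by simp⟩
    · simp only [indMap_mk, he2]
    · rintro z ⟨hz1, hz2⟩
      obtain ⟨c, e', rfl⟩ := indMk_surjective H z
      rw [indMap_mk, indMk_eq] at hz1 hz2
      obtain ⟨s1, hs1, hx1⟩ := hz1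
      obtain ⟨s2, hs2, hy2⟩ := hz2
      refine (indMk_eq H).2 ⟨s2, hs2, hu _ ⟨?_, ?_⟩⟩
      · have hss : s2 = s * s1 := by
          apply Subtype.ext
          apply mul_left_cancel (a := b)
          rw [hs2, Subgroup.coe_mul, ← mul_assoc, hs, hs1]
        rw [map_smul, hss, mul_smul, hx1]
      · rw [map_smul, hy2]

theorem isDisjointUnion_ind {X Y Z : FinGSet H} {i : X →[H] Z} {j : Y →[H] Z}
    (h : IsDisjointUnion i j) : IsDisjointUnion (indMap H i) (indMap H j) := by
  have hi : ∀ x x', i x = i x' → x = x' := fun x x' e =>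
    Sum.inl_injective (h.1 (a₁ := Sum.inl x) (a₂ := Sum.inl x') e)
  have hj : ∀ x x', j x = j x' → x = x' := fun x x' e =>
    Sum.inr_injective (h.1 (a₁ := Sum.inr x) (a₂ := Sum.inr x') e)
  have hij : ∀ x y, i x ≠ j y := fun x y e =>
    Sum.inl_ne_inr (h.1 (a₁ := Sum.inl x) (a₂ := Sum.inr y) e)
  constructor
  · rintro (c | c) (d | d) hcd
    all_goals
      obtain ⟨a, x, rfl⟩ := indMk_surjective H c
      obtain ⟨b, y, rfl⟩ := indMk_surjective H d
      simp only [Sum.elim_inl, Sum.elim_inr, indMap_mk, indMk_eq] at hcd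
      obtain ⟨s, hs, hxy⟩ := hcd
      rw [← map_smul] at hxy
    · exact congrArg Sum.inl ((indMk_eq H).2 ⟨s, hs, hi _ _ hxy⟩)
    · exact (hij _ _ hxy).elim
    · exact (hij _ _ hxy.symm).elim
    · exact congrArg Sum.inr ((indMk_eq H).2 ⟨s, hs, hj _ _ hxy⟩)
  · intro c
    obtain ⟨a, z, rfl⟩ := indMk_surjective H c
    obtain ⟨x | y, rfl⟩ := h.2 z
    · exact ⟨Sum.inl (indMk H a x), rfl⟩
    · exact ⟨Sum.inr (indMk H a y), rfl⟩

/-- The evaluation map `F_H(G, T) × G/H ⟶ G ×_H T`, `(φ, a H) ↦ [a, φ(a⁻¹)]`. -/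
def evalMap (T : FinGSet H) : prod (coind H T) (orbit H) →[G] ind H T where
  toFun c := Quotient.liftOn' c.2 (fun a => indMk H a (c.1.1 a⁻¹)) (by
    intro a b hab
    rw [QuotientGroup.leftRel_apply] at hab
    refine (indMk_eq H).2 ⟨⟨b⁻¹ * a, by simpa using H.inv_mem hab⟩, by simp, ?_⟩
    rw [← c.1.2]
    simp)
  map_smul' b c := by
    obtain ⟨φ, x⟩ := c
    induction x using QuotientGroup.induction_on with
    | H a =>
      change indMk H (b * a) (φ.1 ((b * a)⁻¹ * b)) = indMk H (b * a) (φ.1 a⁻¹)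
      simp

/-- The projection `F_H(G, T) × G/H ⟶ F_H(G, T)`. -/
def coindProj (T : FinGSet H) : prod (coind H T) (orbit H) →[G] coind H T :=
  MulActionHom.fst _ _ _

/-- The isomorphism `G ×_H H/H ⟶ G/H`. -/
def indPt : ind H pt →[G] orbit H where
  toFun := Quotient.lift (fun p => (QuotientGroup.mk p.1 : G ⧸ H)) (by
    rintro p q ⟨h, h1, -⟩
    exact QuotientGroup.eq.2 (by rw [← h1]; simp))
  map_smul' b := by
    rintro ⟨a, t⟩
    rfl

/-- The isomorphism `G/G ⟶ F_H(G, H/H)`. -/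
def toCoindPt : (orbit ⊤ : FinGSet G) →[G] coind H pt where
  toFun _ := ⟨fun _ => PUnit.unit, fun _ _ => rfl⟩
  map_smul' _ _ := rfl

end FinGSet

/-! ### The external norm -/

namespace MackeyFunctor

variable {G : Type u} [Group G] [Finite G] (H : Subgroup G)

/-- The restriction `i_H^* M` of a Mackey functor to a subgroup: `(i_H^* M)(T) = M(G ×_H T)`. -/
abbrev restrict (M : MackeyFunctor.{u, w} G) : MackeyFunctor.{u, w} H where
  obj T := M.obj (ind H T)
  res f := M.res (indMap H f)
  tr f := M.tr (indMap H f)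
  res_id X m := by
    rw [show indMap H (MulActionHom.id H : X →[H] X) = MulActionHom.id G by
      ext c; obtain ⟨a, x, rfl⟩ := indMk_surjective H c; rfl, M.res_id]
  tr_id X m := by
    rw [show indMap H (MulActionHom.id H : X →[H] X) = MulActionHom.id G by
      ext c; obtain ⟨a, x, rfl⟩ := indMk_surjective H c; rfl, M.tr_id]
  res_comp f k m := by
    rw [← M.res_comp, show indMap H (k.comp f) = (indMap H k).comp (indMap H f) by
      ext c; obtain ⟨a, x, rfl⟩ := indMk_surjective H c; rfl]
  tr_comp f k m := by
    rw [← M.tr_comp, show indMap H (k.comp f) = (indMap H k).comp (indMap H f) by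
      ext c; obtain ⟨a, x, rfl⟩ := indMk_surjective H c; rfl]
  res_tr _ _ _ _ h m := M.res_tr _ _ _ _ (isPullbackSquare_ind H h) m
  empty X hX := M.empty _ ⟨fun c => by
    obtain ⟨a, x, rfl⟩ := indMk_surjective H c
    exact hX.elim x⟩
  disjoint _ _ h := M.disjoint _ _ (isDisjointUnion_ind H h)

/-- A representative of an element of the norm `(N_H^G M)(Y)`: a finite `H`-set `T`, a span
`F_H(G, T) ⟵ U ⟶ Y` of finite `G`-sets and an element of `M(T)`. -/
structure NormRep (M : MackeyFunctor.{u, w} H) (Y : FinGSet G) where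
  {T : FinGSet H}
  {U : FinGSet G}
  v : U →[G] coind H T
  y : U →[G] Y
  m : M.obj T

/-- The relations of the coend: isomorphic spans are identified, and restrictions and transfers
along a map `f` of `H`-sets may be moved to the span through `F_H(G, f)`. -/
inductive NormRel (M : MackeyFunctor.{u, w} H) (Y : FinGSet G) :
    NormRep H M Y → NormRep H M Y → Prop
  | iso {T : FinGSet H} {U U' : FinGSet G} (θ : U' →[G] U) (_ : Function.Bijective θ)
      (v : U →[G] coind H T) (y : U →[G] Y) (m : M.obj T) :
      NormRel M Y ⟨v, y, m⟩ ⟨v.comp θ, y.comp θ, m⟩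
  | res {T T' : FinGSet H} {U : FinGSet G} (f : T →[H] T')
      (v : U →[G] coind H T) (y : U →[G] Y) (m : M.obj T') :
      NormRel M Y ⟨v, y, M.res f m⟩ ⟨(coindMap H f).comp v, y, m⟩
  | tr {T T' : FinGSet H} {U V : FinGSet G} (f : T →[H] T')
      (v : U →[G] coind H T') (y : U →[G] Y) (v' : V →[G] coind H T) (p : V →[G] U)
      (_ : IsPullbackSquare v' p (coindMap H f) v) (m : M.obj T) :
      NormRel M Y ⟨v, y, M.tr f m⟩ ⟨v', y.comp p, m⟩

/-- The value at `Y` of the norm `N_H^G M` of an `H`-Mackey functor: the left Kan extension of `M`,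
as a functor to sets, along `F_H(G, -)` on Burnside categories, by the pointwise (coend) formula. -/
def Norm (M : MackeyFunctor.{u, w} H) (Y : FinGSet G) : Type max (u + 1) w :=
  Quot (NormRel H M Y)

end MackeyFunctor

namespace TambaraFunctor

variable {G : Type u} [Group G] [Finite G] (R : TambaraFunctor.{u, w} G) (H : Subgroup G)

/-- The external norm `N^{G/H} R = N_H^G i_H^* R`, evaluated at `Y`. -/
abbrev ExternalNorm (Y : FinGSet G) : Type max (u + 1) w :=
  MackeyFunctor.Norm H (R.toMackey.restrict H) Y

/-- The norm map `N_H^G : R(G/H) ⟶ (N^{G/H} R)(G/G)`: the identification of `R(G/H)` with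
`(i_H^* R)(H/H)` followed by the universal map to the left Kan extension and the identification of
`F_H(G, H/H)` with `G/G`. -/
def toExternalNorm (r : R.obj (orbit H)) : R.ExternalNorm H (orbit ⊤) :=
  Quot.mk _ ⟨toCoindPt H, MulActionHom.id G, R.res (indPt H) r⟩

/-- The norm `R(G ×_H T) ⟶ R(F_H(G, T))` along the projection
`F_H(G, T) × G/H ⟶ F_H(G, T)`, after restriction along the evaluation map. -/
def coindNorm (T : FinGSet H) (m : R.obj (ind H T)) : R.obj (coind H T) :=
  R.nm (coindProj H T) (R.res (evalMap H T) m)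

theorem coindNorm_res {T T' : FinGSet H} (f : T →[H] T') (m : R.obj (ind H T')) :
    R.coindNorm H T (R.res (indMap H f) m) = R.res (coindMap H f) (R.coindNorm H T' m) := by
  let l : prod (coind H T) (orbit H) →[G] prod (coind H T') (orbit H) :=
    MulActionHom.prodMap (coindMap H f) (MulActionHom.id G)
  have hsq : IsPullbackSquare l (coindProj H T) (coindProj H T') (coindMap H f) :=
    ⟨fun _ => rfl, fun c φ h => ⟨(φ, c.2), ⟨Prod.ext h.symm rfl, rfl⟩, fun d hd =>
      Prod.ext hd.2 (show d.2 = c.2 from congrArg (fun z : (coind H T') × (G ⧸ H) => z.2) hd.1)⟩⟩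
  have hev : (indMap H f).comp (evalMap H T) = (evalMap H T').comp l := by
    ext ⟨φ, x⟩
    induction x using QuotientGroup.induction_on
    rfl
  rw [coindNorm, coindNorm, R.res_nm _ _ _ _ hsq, ← R.res_comp, ← R.res_comp, hev]

theorem exists_section {T T' : FinGSet H} (f : T →[H] T') (x : ind H T) (a : G) (t' : T')
    (h : indMap H f x = indMk H a t') : ∃ t : T, indMk H a t = x ∧ f t = t' := by
  obtain ⟨b, s, rfl⟩ := indMk_surjective H x
  rw [indMap_mk, indMk_eq] at h
  obtain ⟨k, hk, hs⟩ := h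
  exact ⟨k • s, (indMk_eq H).2 ⟨k⁻¹, by simp [← hk], by simp⟩, by rw [map_smul, hs]⟩

theorem indMk_injective {T : FinGSet H} (a : G) {t s : T} (h : indMk H a t = indMk H a s) :
    t = s := by
  obtain ⟨k, hk, hs⟩ := (indMk_eq H).1 h
  have : k = 1 := Subtype.ext (mul_left_cancel (hk.trans (mul_one a).symm))
  rw [← hs, this, one_smul]

theorem indMk_mul {T : FinGSet H} (a : G) (k : H) (t : T) :
    indMk H (a * k) t = indMk H a (k • t) :=
  (indMk_eq H).2 ⟨k, rfl, rfl⟩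

theorem coindNorm_tr {T T' : FinGSet H} (f : T →[H] T') (m : R.obj (ind H T)) :
    R.coindNorm H T' (R.tr (indMap H f) m) = R.tr (coindMap H f) (R.coindNorm H T m) := by
  let l : prod (coind H T) (orbit H) →[G] prod (coind H T') (orbit H) :=
    MulActionHom.prodMap (coindMap H f) (MulActionHom.id G)
  have hev : ∀ c, indMap H f (evalMap H T c) = evalMap H T' (l c) := by
    rintro ⟨φ, x⟩
    induction x using QuotientGroup.induction_on
    rfl
  let A := pullback (indMap H f) (evalMap H T')
  let e : prod (coind H T) (orbit H) →[G] A :=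
    { toFun := fun c => ⟨(evalMap H T c, l c), hev c⟩
      map_smul' := fun b c => Subtype.ext (Prod.ext (map_smul _ b c) (map_smul l b c)) }
  have hexp : IsExponential (pullbackSnd (indMap H f) (evalMap H T')) (coindProj H T') e l
      (coindProj H T) (coindMap H f) := by
    refine ⟨⟨fun _ => rfl, fun c φ h => ⟨(φ, c.2), ⟨Prod.ext h.symm rfl, rfl⟩, fun d hd =>
      Prod.ext hd.2 (show d.2 = c.2 from congrArg (fun z : (coind H T') × (G ⧸ H) => z.2) hd.1)⟩⟩, fun _ => rfl, ?_⟩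
    intro φ' s hs
    let sec : G → ind H T := fun a => (s (φ', (QuotientGroup.mk a : G ⧸ H)) rfl).1.1
    have hsec : ∀ a, indMap H f (sec a) = indMk H a (φ'.1 a⁻¹) := fun a => by
      have h1 := (s (φ', (QuotientGroup.mk a : G ⧸ H)) rfl).2
      have h2 := hs (φ', (QuotientGroup.mk a : G ⧸ H)) rfl
      refine h1.trans ?_
      exact congrArg (evalMap H T') h2
    choose t ht hft using fun a : G => exists_section H f (sec a⁻¹) a⁻¹ (φ'.1 a) (by
      rw [hsec, inv_inv])
    have hcos : ∀ (h : H) (a : G), sec ((h * a)⁻¹) = sec a⁻¹ := fun h a => by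
      have : (QuotientGroup.mk ((h * a)⁻¹) : G ⧸ H) = QuotientGroup.mk a⁻¹ :=
        QuotientGroup.eq.2 (by simp)
      simp only [sec, this]
    let φ : coind H T := ⟨t, fun h a => indMk_injective H ((h * a : G)⁻¹) (by
      rw [ht, hcos, ← ht, mul_inv_rev, ← Subgroup.coe_inv, indMk_mul, inv_smul_smul])⟩
    have hφ : ∀ a : G, evalMap H T (φ, (QuotientGroup.mk a : G ⧸ H)) = sec a := fun a => by
      change indMk H a (t a⁻¹) = sec a
      have := ht a⁻¹
      rwa [inv_inv] at this
    refine ⟨φ, ⟨Subtype.ext (funext hft), ?_⟩, ?_⟩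
    · rintro ⟨ψ, x⟩ hc hψ
      change ψ = φ at hψ
      subst hψ
      induction x using QuotientGroup.induction_on with
      | H a =>
        have hl : l (φ, (QuotientGroup.mk a : G ⧸ H)) = (φ', (QuotientGroup.mk a : G ⧸ H)) :=
          Prod.ext hc rfl
        refine Subtype.ext (Prod.ext ?_ (hs _ hc).symm)
        refine (hφ a).trans ?_
        simp only [sec, hl]
        rfl
    · rintro ψ ⟨hψ1, hψ2⟩
      refine Subtype.ext (funext fun a => indMk_injective H a⁻¹ ?_)
      change _ = indMk H a⁻¹ (t a)
      rw [ht]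
      have h3 := hψ2 (ψ, (QuotientGroup.mk a⁻¹ : G ⧸ H)) hψ1 rfl
      have hl : l (ψ, (QuotientGroup.mk a⁻¹ : G ⧸ H)) = (φ', (QuotientGroup.mk a⁻¹ : G ⧸ H)) :=
        Prod.ext hψ1 rfl
      have h4 : evalMap H T (ψ, (QuotientGroup.mk a⁻¹ : G ⧸ H)) = sec a⁻¹ := by
        refine (congrArg (fun z => z.1.1) h3).trans ?_
        simp only [sec, hl]
        rfl
      refine Eq.trans ?_ h4
      change _ = indMk H a⁻¹ (ψ.1 (a⁻¹)⁻¹)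
      rw [inv_inv]
  rw [coindNorm, coindNorm, R.res_tr _ _ _ _ (isPullbackSquare_pullback (indMap H f)
    (evalMap H T')), R.nm_tr _ _ _ _ _ _ hexp, ← R.res_comp]
  rfl

/-- The structure map `n_H^G : N^{G/H} R ⟶ R` of the Tambara functor `R`, evaluated at `Y`. It is
the map out of the left Kan extension induced by the natural transformation
`R(G ×_H T) ⟶ R(F_H(G, T))`. -/
def ofExternalNorm (Y : FinGSet G) : R.ExternalNorm H Y → R.obj Y :=
  Quot.lift (fun b => R.tr b.y (R.res b.v (R.coindNorm H b.T b.m))) (by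
    intro b b' h
    induction h with
    | @iso T U U' θ hθ v y m =>
      change R.tr y (R.res v (R.coindNorm H T m)) =
        R.tr (y.comp θ) (R.res (v.comp θ) (R.coindNorm H T m))
      rw [R.tr_comp, R.res_comp, R.tr_res_of_bijective θ hθ]
    | @res T T' U f v y m =>
      change R.tr y (R.res v (R.coindNorm H T (R.res (indMap H f) m))) =
        R.tr y (R.res ((coindMap H f).comp v) (R.coindNorm H T' m))
      rw [R.res_comp, R.coindNorm_res]
    | @tr T T' U V f v y v' p hsq m =>
      change R.tr y (R.res v (R.coindNorm H T' (R.tr (indMap H f) m))) =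
        R.tr (y.comp p) (R.res v' (R.coindNorm H T m))
      rw [R.tr_comp, R.coindNorm_tr, R.res_tr _ _ _ _ hsq])

end TambaraFunctor

/-! The map `t` is the norm `N` along `G/H ⟶ G/G` followed by the projection to the Witt vectors.
The point is that this composite, which is not additive, still factors through the coinvariants.

The elements `r + s y` and `r + s (g y)` of `R(X)` are transfers along the fold map `X ⊔ X ⟶ X` of
`(r, s)·(1, y)` and `(r, s)·(1, g y)`. Over a one-point target, the dependent product of the fold
map is the power set of `X` (`isExponential_fold`), so the distributive law writes the two norms as
transfers from `𝒫(X)` of `C·D` and `C·(g D)`, with the same `C` and `D`. Here `g` may be pulled out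
because its action commutes with restrictions and norms, and fixes `1`. The difference is the
transfer of `C·(D - g D)`, which is a boundary (`nm_sub_nm_mem_boundaryIdeal`). Iterating over
powers of the generator and over sums of multiples gives invariance under the whole coinvariants
ideal (`nmWitt_add`).

For the restriction, base change replaces the norm by one along a projection `G/H × G/H ⟶ G/H`.
Since `G` is abelian, the source is the disjoint union of the graphs of translations, so the norm
restricts to a product of `|G/H|` translates of `r` (`res_nm_orbitMap`), all of which agree in the
Witt vectors. Naturality is compatibility of morphisms with norms, and the comparison with the
external norm (`ofExternalNorm_toExternalNorm`) is one further base change. -/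

/-! ### Power sets and the exponential diagram of the fold map -/

open scoped Pointwise in
/-- The power set of a finite `G`-set. -/
def FinGSet.powerset {G : Type u} [Group G] (X : FinGSet G) : FinGSet G := ⟨Set X⟩

/-- The disjoint union of two finite `G`-sets. -/
def FinGSet.sum {G : Type u} [Group G] (X Y : FinGSet G) : FinGSet G :=
  letI : MulAction G (X ⊕ Y) :=
    { smul := fun b => Sum.map (b • ·) (b • ·)
      one_smul := by rintro (x | x) <;> exact congrArg _ (one_smul G x)
      mul_smul := by rintro b c (x | x) <;> exact congrArg _ (mul_smul b c x) }
  ⟨X ⊕ Y⟩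

namespace FinGSet

variable {G : Type u} [Group G]

/-- The first inclusion into a disjoint union. -/
def inl (X Y : FinGSet G) : X →[G] sum X Y := ⟨Sum.inl, fun _ _ => rfl⟩

/-- The second inclusion into a disjoint union. -/
def inr (X Y : FinGSet G) : Y →[G] sum X Y := ⟨Sum.inr, fun _ _ => rfl⟩

theorem isDisjointUnion_sum (X Y : FinGSet G) : IsDisjointUnion (inl X Y) (inr X Y) := by
  constructor
  · rintro (x | x) (y | y) h
    all_goals exact h
  · rintro (x | x)
    exacts [⟨Sum.inl x, rfl⟩, ⟨Sum.inr x, rfl⟩]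

/-- The fold map `X ⊔ X ⟶ X`. -/
def fold (X : FinGSet G) : sum X X →[G] X :=
  ⟨Sum.elim id id, by rintro b (x | x) <;> rfl⟩

/-- The membership relation between a finite `G`-set and its power set. -/
def IsMem {X : FinGSet G} (x : X) (S : powerset X) : Prop := Set.Mem S x

theorem isMem_smul {X : FinGSet G} (b : G) (x : X) (S : powerset X) :
    IsMem (b • x) (b • S) ↔ IsMem x S :=
  Set.smul_mem_smul_set_iff (s := (show Set X from S))

open Classical in
/-- The point `x` of the second summand of `X ⊔ X` if `x ∈ S` and of the first one otherwise. -/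
noncomputable def splitPt {X : FinGSet G} (x : X) (S : powerset X) : sum X X :=
  if IsMem x S then inr X X x else inl X X x

theorem splitPt_of_mem {X : FinGSet G} {x : X} {S : powerset X} (h : IsMem x S) :
    splitPt x S = inr X X x :=
  if_pos h

theorem splitPt_of_not_mem {X : FinGSet G} {x : X} {S : powerset X} (h : ¬IsMem x S) :
    splitPt x S = inl X X x :=
  if_neg h

theorem inl_ne_inr {X Y : FinGSet G} {x : X} {y : Y} : inl X Y x ≠ inr X Y y := Sum.inl_ne_inr

/-- The map `X × 𝒫(X) ⟶ X ⊔ X` which sends `(x, S)` to `x` in the second summand if `x ∈ S` and in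
the first summand otherwise. -/
noncomputable def splitMap (X : FinGSet G) : prod X (powerset X) →[G] sum X X where
  toFun c := splitPt c.1 c.2
  map_smul' b := by
    rintro ⟨x, S⟩
    change splitPt (b • x) (b • S) = b • splitPt x S
    by_cases hx : IsMem x S
    · rw [splitPt_of_mem hx, splitPt_of_mem ((isMem_smul b x S).2 hx), map_smul]
    · rw [splitPt_of_not_mem hx, splitPt_of_not_mem (mt (isMem_smul b x S).1 hx), map_smul]

/-- The first projection of a product. -/
def prodFst (X Y : FinGSet G) : prod X Y →[G] X := ⟨Prod.fst, fun _ _ => rfl⟩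

/-- The second projection of a product. -/
def prodSnd (X Y : FinGSet G) : prod X Y →[G] Y := ⟨Prod.snd, fun _ _ => rfl⟩

theorem isPullbackSquare_prod (X Y : FinGSet G) {Z : FinGSet G} [Subsingleton Z] (f : X →[G] Z)
    (k : Y →[G] Z) : IsPullbackSquare (prodFst X Y) (prodSnd X Y) f k :=
  ⟨fun _ => Subsingleton.elim _ _, fun x y _ => ⟨(x, y), ⟨rfl, rfl⟩, fun _ hd =>
    Prod.ext hd.1 hd.2⟩⟩

/-- Since `h` has nonempty source, `Y` is a point, with fibre all of `X`. A section of the fold map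
chooses a summand at each point of `X`, which amounts to the subset where the second summand is
chosen. -/
theorem isExponential_fold {X Y : FinGSet G} [Subsingleton Y] (f : X →[G] Y)
    (h : powerset X →[G] Y) :
    IsExponential (fold X) f (splitMap X) (prodFst X (powerset X)) (prodSnd X (powerset X)) h := by
  refine ⟨isPullbackSquare_prod _ _ _ _, ?_, ?_⟩
  · rintro ⟨x, S⟩
    change fold X (splitPt x S) = x
    by_cases hx : IsMem x S
    · rw [splitPt_of_mem hx]
      rfl
    · rw [splitPt_of_not_mem hx]
      rfl
  · intro y s hs
    have hsx : ∀ x hx, s x hx = inl X X x ∨ s x hx = inr X X x := by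
      intro x hx
      have := hs x hx
      obtain ⟨a | a, ha⟩ := (isDisjointUnion_sum X X).2 (s x hx) <;> rw [← ha] at this ⊢
      · exact Or.inl (congrArg (inl X X) this)
      · exact Or.inr (congrArg (inr X X) this)
    -- The fibre condition on `x` holds automatically over a subsingleton, so the section is defined
    -- on all of `X`.
    let S₀ : powerset X := {x : X | s x (Subsingleton.elim _ _) = inr X X x}
    have hS₀ : ∀ x, IsMem x S₀ ↔ s x (Subsingleton.elim _ _) = inr X X x := fun _ => Iff.rfl
    refine ⟨S₀, ⟨Subsingleton.elim _ _, ?_⟩, ?_⟩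
    · rintro ⟨x, S⟩ hc hS
      change S = S₀ at hS
      subst hS
      change splitPt x S₀ = s x hc
      rcases hsx x hc with h' | h'
      · rw [splitPt_of_not_mem, h']
        exact fun hmem => inl_ne_inr (h'.symm.trans hmem)
      · rw [splitPt_of_mem ((hS₀ x).2 h'), h']
    -- Uniqueness: evaluation recovers the subset, because `splitPt x S` lies in the second summand
    -- exactly when `x ∈ S`.
    · rintro S ⟨-, hS⟩
      refine Set.ext fun x => ?_
      have hx : splitPt x S = s x _ := hS (x, S) (Subsingleton.elim _ _) rfl
      change IsMem x S ↔ IsMem x S₀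
      rw [hS₀, ← hx]
      by_cases h' : IsMem x S
      · exact ⟨fun _ => splitPt_of_mem h', fun _ => h'⟩
      · rw [splitPt_of_not_mem h']
        exact ⟨fun h => (h' h).elim, fun h => (inl_ne_inr h).elim⟩

instance [Finite G] : Subsingleton (orbit (⊤ : Subgroup G)) :=
  QuotientGroup.subsingleton_quotient_top

/-! ### Partial unions of sections -/

/-- The sub-`G`-set of points of `Z` which lie on one of the sections `s i` of `k`, `i ∈ t`. -/
def sectionUnion {ι : Type*} {X Z : FinGSet G} (k : Z →[G] X) (s : ι → X →[G] Z) (t : Finset ι) :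
    FinGSet G :=
  letI : MulAction G {z : Z // ∃ i ∈ t, s i (k z) = z} :=
    { smul := fun b z => ⟨b • z.1, by
        obtain ⟨i, hi, h⟩ := z.2
        exact ⟨i, hi, by rw [map_smul, map_smul, h]⟩⟩
      one_smul := fun z => Subtype.ext (one_smul G z.1)
      mul_smul := fun b c z => Subtype.ext (mul_smul b c z.1) }
  ⟨{z : Z // ∃ i ∈ t, s i (k z) = z}⟩

/-- The inclusion of a union of sections. -/
def sectionUnionVal {ι : Type*} {X Z : FinGSet G} (k : Z →[G] X) (s : ι → X →[G] Z)
    (t : Finset ι) : sectionUnion k s t →[G] Z :=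
  ⟨Subtype.val, fun _ _ => rfl⟩

end FinGSet

/-! ### Transfers along fold maps -/

namespace GreenFunctor

variable {G : Type u} [Group G] (R : GreenFunctor.{u, w} G)

/-- Transfer along the fold map is addition. -/
theorem tr_fold {X : FinGSet G} (m : R.obj (sum X X)) :
    R.tr (fold X) m = R.res (inl X X) m + R.res (inr X X) m := by
  obtain ⟨hinj, -⟩ := R.disjoint _ _ (isDisjointUnion_sum X X)
  have hE : IsEmpty (pullback (inl X X) (inr X X)) := ⟨fun a => Sum.inl_ne_inr a.2⟩
  have hE' : IsEmpty (pullback (inr X X) (inl X X)) := ⟨fun a => Sum.inr_ne_inl a.2⟩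
  have := R.empty _ hE
  have := R.empty _ hE'
  -- Checked on each summand: the diagonal terms are recovered by base change along identities, and
  -- the cross terms vanish because they factor through the value at the empty set.
  have hm : m = R.tr (inl X X) (R.res (inl X X) m) + R.tr (inr X X) (R.res (inr X X) m) := by
    refine hinj (Prod.ext ?_ ?_)
    · simp only [map_add]
      rw [R.res_tr (MulActionHom.id G) (MulActionHom.id G) _ _ ⟨fun _ => rfl, fun c d h =>
        ⟨c, ⟨rfl, Sum.inl_injective h⟩, fun e he => he.1⟩⟩, R.res_id, R.tr_id,
        R.res_tr _ _ _ _ (isPullbackSquare_pullback (inr X X) (inl X X)),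
        Subsingleton.elim (R.res (pullbackFst (inr X X) (inl X X)) _) 0, map_zero, add_zero]
    · simp only [map_add]
      rw [R.res_tr (MulActionHom.id G) (MulActionHom.id G) (inr X X) _ ⟨fun _ => rfl, fun c d h =>
        ⟨c, ⟨rfl, Sum.inr_injective h⟩, fun e he => he.1⟩⟩, R.res_id, R.tr_id,
        R.res_tr _ _ _ _ (isPullbackSquare_pullback (inl X X) (inr X X)),
        Subsingleton.elim (R.res (pullbackFst (inl X X) (inr X X)) _) 0, map_zero, zero_add]
  conv_lhs => rw [hm, map_add, ← R.tr_comp, ← R.tr_comp]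
  exact congrArg₂ _ (R.tr_id X _) (R.tr_id X _)

end GreenFunctor

/-! ### Norms along disjoint unions -/

namespace TambaraFunctor

section

variable {G : Type u} [Group G] (R : TambaraFunctor.{u, w} G)

/-- For bijective `θ`, the composite of restriction and transfer is the identity, so it can be
inserted around the norm; base change then cancels the norm against the restriction. -/
theorem nm_res_of_bijective {U V : FinGSet G} (θ : U →[G] V) (hθ : Function.Bijective θ)
    (m : R.obj V) : R.nm θ (R.res θ m) = m := by
  rw [← R.tr_res_of_bijective θ hθ (R.nm θ _), R.res_nm (MulActionHom.id G) (MulActionHom.id G) θ θ ⟨fun _ => rfl, fun c d h =>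
      ⟨c, ⟨rfl, hθ.1 h⟩, fun e he => he.1⟩⟩, R.res_id, R.nm_id,
    R.tr_res_of_bijective θ hθ]

/-- The norm of an element on a disjoint union is the product of the norms. -/
theorem nm_of_isDisjointUnion {X Y Z W : FinGSet G} {i : X →[G] Z} {j : Y →[G] Z}
    (h : IsDisjointUnion i j) (f : Z →[G] W) (m : R.obj Z) :
    R.nm f m = R.nm (f.comp i) (R.res i m) * R.nm (f.comp j) (R.res j m) := by
  have hE : IsEmpty (pullback i j) := ⟨fun a => Sum.inl_ne_inr (h.1 (a₁ := Sum.inl a.1.1)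
    (a₂ := Sum.inr a.1.2) a.2)⟩
  have hE' : IsEmpty (pullback j i) := ⟨fun a => Sum.inr_ne_inl (h.1 (a₁ := Sum.inr a.1.1)
    (a₂ := Sum.inl a.1.2) a.2)⟩
  have := R.empty _ hE
  have := R.empty _ hE'
  -- The multiplicative analogue of the decomposition by transfers: a cross term is the norm of an
  -- element over the empty set, where every element equals `1`.
  have hm : m = R.nm i (R.res i m) * R.nm j (R.res j m) := by
    refine (R.disjoint i j h).1 (Prod.ext ?_ ?_)
    · simp only [map_mul]
      rw [R.res_nm (MulActionHom.id G) (MulActionHom.id G) i i ⟨fun _ => rfl, fun c d hcd =>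
        ⟨c, ⟨rfl, Sum.inl_injective (h.1 (a₁ := Sum.inl c) (a₂ := Sum.inl d) hcd)⟩,
          fun e he => he.1⟩⟩, R.res_id, R.nm_id,
        R.res_nm _ _ _ _ (isPullbackSquare_pullback j i),
        Subsingleton.elim (R.res (pullbackFst j i) _) 1, map_one, mul_one]
    · simp only [map_mul]
      rw [R.res_nm (MulActionHom.id G) (MulActionHom.id G) j j ⟨fun _ => rfl, fun c d hcd =>
        ⟨c, ⟨rfl, Sum.inr_injective (h.1 (a₁ := Sum.inr c) (a₂ := Sum.inr d) hcd)⟩,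
          fun e he => he.1⟩⟩, R.res_id, R.nm_id,
        R.res_nm _ _ _ _ (isPullbackSquare_pullback i j),
        Subsingleton.elim (R.res (pullbackFst i j) _) 1, map_one, one_mul]
  conv_lhs => rw [hm, map_mul, ← R.nm_comp, ← R.nm_comp]

/-- The norm along a map that splits into finitely many disjoint sections is the product of the
restrictions along the sections. -/
theorem nm_eq_prod {ι : Type*} [Fintype ι] {X Z : FinGSet G} (k : Z →[G] X) (s : ι → X →[G] Z)
    (hs : ∀ i x, k (s i x) = x) (hdisj : ∀ i j x, s i x = s j x → i = j)
    (hsurj : ∀ z, ∃ i, s i (k z) = z) (m : R.obj Z) :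
    R.nm k m = ∏ i, R.res (s i) m := by
  classical
  -- Sections are added one at a time. The norm over the image of a single section is the
  -- restriction along it, because `k` composed with that section is the identity.
  have key : ∀ t : Finset ι, R.nm (k.comp (sectionUnionVal k s t))
      (R.res (sectionUnionVal k s t) m) = ∏ i ∈ t, R.res (s i) m := by
    intro t
    induction t using Finset.induction_on with
    | empty =>
      have hE : IsEmpty (sectionUnion k s ∅) := ⟨fun z => by
        obtain ⟨i, hi, -⟩ := z.2
        simp at hi⟩
      have := R.empty _ hE
      rw [Subsingleton.elim (R.res _ m) 1, map_one, Finset.prod_empty]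
    | insert a t ha ih =>
      let i : X →[G] sectionUnion k s (insert a t) :=
        ⟨fun x => ⟨s a x, a, Finset.mem_insert_self a t, by rw [hs]⟩,
          fun b x => Subtype.ext (map_smul (s a) b x)⟩
      let j : sectionUnion k s t →[G] sectionUnion k s (insert a t) :=
        ⟨fun z => ⟨z.1, by
          obtain ⟨c, hc, h⟩ := z.2
          exact ⟨c, Finset.mem_insert_of_mem hc, h⟩⟩, fun _ _ => rfl⟩
      have hij : IsDisjointUnion i j := by
        have hne : ∀ x z, i x ≠ j z := by
          rintro x ⟨z, c, hc, h⟩ hxz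
          have hz : s a x = z := congrArg Subtype.val hxz
          rw [← hz, hs] at h
          exact ha (hdisj _ _ _ h ▸ hc)
        constructor
        · rintro (x | x) (y | y) h
          · have h' : s a x = s a y := congrArg Subtype.val h
            exact congrArg Sum.inl (by rw [← hs a x, h', hs])
          · exact (hne _ _ h).elim
          · exact (hne _ _ h.symm).elim
          · have h' : (j x).1 = (j y).1 := congrArg Subtype.val h
            exact congrArg Sum.inr (Subtype.ext h')
        · rintro ⟨z, c, hc, h⟩
          rcases Finset.mem_insert.1 hc with rfl | hc
          · exact ⟨Sum.inl (k z), Subtype.ext h⟩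
          · exact ⟨Sum.inr ⟨z, c, hc, h⟩, rfl⟩
      have h1 : (k.comp (sectionUnionVal k s (insert a t))).comp i = MulActionHom.id G := by
        ext x
        exact hs a x
      rw [R.nm_of_isDisjointUnion hij, h1, R.nm_id, ← R.res_comp, ← R.res_comp,
        Finset.prod_insert ha, ← ih]
      rfl
  -- For `t = Finset.univ` the union is all of `Z`, by `hsurj`.
  rw [← key, R.nm_comp, R.nm_res_of_bijective]
  exact ⟨Subtype.val_injective, fun z => ⟨⟨z, by simpa using hsurj z⟩, rfl⟩⟩

variable [Finite G]

/-! ### Comparison with the external norm -/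

/-- The composite of the universal map to the external norm and the structure map is the norm. -/
theorem ofExternalNorm_toExternalNorm (H : Subgroup G) (r : R.obj (orbit H)) :
    R.ofExternalNorm H (orbit ⊤) (R.toExternalNorm H r) = R.nm (orbitMap le_top) r := by
  change R.tr (MulActionHom.id G) (R.res (toCoindPt H) (R.nm (coindProj H pt)
    (R.res (evalMap H pt) (R.res (indPt H) r)))) = _
  -- As `F_H(G, H/H)` is a point, `p` exhibits `G/H` as the pullback of `coindProj` along
  -- `toCoindPt`. Evaluation on this slice is inverse to `indPt`.
  let p : orbit H →[G] prod (coind H pt) (orbit H) :=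
    ⟨fun x => (toCoindPt H (orbitMap le_top x), x), fun _ _ => rfl⟩
  have hsq : IsPullbackSquare p (orbitMap le_top) (coindProj H pt) (toCoindPt H) :=
    ⟨fun _ => rfl, fun c _ _ => ⟨c.2, ⟨Prod.ext (Subtype.ext rfl) rfl, Subsingleton.elim _ _⟩,
      fun d hd => congrArg Prod.snd hd.1⟩⟩
  have hid : (indPt H).comp ((evalMap H pt).comp p) = MulActionHom.id G := by
    ext x
    induction x using QuotientGroup.induction_on
    rfl
  rw [R.tr_id, R.res_nm _ _ _ _ hsq, ← R.res_comp, ← R.res_comp, hid, R.res_id]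

end

/-! ### Invariance of the norm modulo the boundary -/

section

variable {G : Type u} [CommGroup G] (R : TambaraFunctor.{u, w} G)

/-- The action is restriction along a translation, and translations form pullback squares with every
equivariant map. -/
theorem act_nm (a : G) {X Y : FinGSet G} (f : X →[G] Y) (m : R.obj X) :
    R.act a Y (R.nm f m) = R.nm f (R.act a X m) :=
  R.res_nm _ _ _ _ (GreenFunctor.isPullbackSquare_translate a f) m

/-- Modulo the image of `d₀ - d₁`, the norm does not see the action of `g`. -/
theorem nm_sub_nm_mem_boundaryIdeal (g : G) {X Y : FinGSet G} [Subsingleton Y] (f : X →[G] Y)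
    (h : powerset X →[G] Y) (r s y : R.obj X) :
    R.nm f (r + s * y) - R.nm f (r + s * R.act g X y) ∈ R.boundaryIdeal g Y := by
  have hsurj := (R.disjoint _ _ (isDisjointUnion_sum X X)).2
  -- Only `d` involves `y`. Its first component is `1`, which is fixed by `g`, so that acting on all
  -- of `d` changes only `y`.
  obtain ⟨c, hc⟩ := hsurj (r, s)
  obtain ⟨d, hd⟩ := hsurj (1, y)
  obtain ⟨hc1, hc2⟩ := Prod.ext_iff.1 hc
  obtain ⟨hd1, hd2⟩ := Prod.ext_iff.1 hd
  dsimp only at hc1 hc2 hd1 hd2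
  have h1 : r + s * y = R.tr (fold X) (c * d) := by
    rw [R.tr_fold, map_mul, map_mul, hc1, hc2, hd1, hd2, mul_one]
  have h2 : r + s * R.act g X y = R.tr (fold X) (c * R.act g _ d) := by
    rw [R.tr_fold, map_mul, map_mul, ← R.act_res, ← R.act_res, hc1, hc2, hd1, hd2, map_one,
      mul_one]
  have hexp := isExponential_fold f h
  -- The distributive law makes both norms transfers from `𝒫(X)`; moving `act g` outside leaves the
  -- transfer of `C * (D - g D)`.
  rw [h1, h2, R.nm_tr _ _ _ _ _ _ hexp, R.nm_tr _ _ _ _ _ _ hexp, ← map_sub, map_mul, map_mul,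
    map_mul, map_mul, ← R.act_res, ← R.act_nm, ← mul_sub]
  exact R.mem_boundaryIdeal g _ _ _

theorem act_mul (a b : G) (X : FinGSet G) (r : R.obj X) :
    R.act (a * b) X r = R.act b X (R.act a X r) := by
  rw [GreenFunctor.act, GreenFunctor.act, GreenFunctor.act, ← R.res_comp]
  congr 2
  ext x
  exact mul_smul a b x

variable [Finite G]

/-- The composite of the norm `R(G/H) ⟶ R(G/G)` and the projection to the Witt vectors. -/
def nmWitt (g : G) (H : Subgroup G) : R.obj (orbit H) →* (R.witt g).obj (orbit ⊤) :=
  (R.toWitt g (orbit ⊤)).toMonoidHom.comp (R.nm (orbitMap le_top))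

/-- This is the well-definedness of `t`. The norm is not additive, so the generators of the ideal
are absorbed one by one, at an arbitrary base point. -/
theorem nmWitt_add (g : G) (hg : ∀ a : G, a ∈ Subgroup.zpowers g) (H : Subgroup G)
    (r : R.obj (orbit H)) {d : R.obj (orbit H)} (hd : d ∈ R.coinvariantsIdeal H) :
    R.nmWitt g H (r + d) = R.nmWitt g H r := by
  have hgen : ∀ r s y, R.nmWitt g H (r + s * R.act g _ y) = R.nmWitt g H (r + s * y) :=
    fun r s y => (Ideal.Quotient.eq.2 (R.nm_sub_nm_mem_boundaryIdeal g (orbitMap le_top)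
      ⟨fun _ => QuotientGroup.mk 1, fun _ _ => Subsingleton.elim _ _⟩ r s y)).symm
  have hpow : ∀ (k : ℕ) r s y,
      R.nmWitt g H (r + s * R.act (g ^ k) _ y) = R.nmWitt g H (r + s * y) := by
    intro k
    induction k with
    | zero => intro r s y; rw [pow_zero, R.act_one]
    | succ k ih => intro r s y; rw [pow_succ, R.act_mul, hgen, ih]
  -- Quantifying over the multiplier `c` and the base point `r` makes the induction close: scalars
  -- are absorbed in `c`, earlier summands in `r`.
  have hmul : ∀ c r, R.nmWitt g H (r + c * d) = R.nmWitt g H r := by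
    induction hd using Submodule.span_induction with
    | zero => intro c r; rw [mul_zero, add_zero]
    | add x y _ _ hx hy => intro c r; rw [mul_add, ← add_assoc, hy, hx]
    | smul b x _ hx => intro c r; rw [smul_eq_mul, ← mul_assoc, hx]
    | mem x hx =>
      obtain ⟨a, y, rfl⟩ := hx
      -- Finiteness of `G` makes nonnegative powers of `g` suffice.
      obtain ⟨k, rfl⟩ := (mem_powers_iff_mem_zpowers (x := g)).2 (hg a)
      intro c r
      -- Rewritten as `(r - c y) + c (g ^ k y)`, to which `hpow` applies with base point `r - c y`.
      rw [mul_sub, add_sub_left_comm, add_comm, sub_add_eq_add_sub, add_sub_right_comm]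
      exact (hpow k (r - c * y) c y).trans (by rw [sub_add_cancel])
  rw [← hmul 1 r, one_mul]

/-- The map of multiplicative monoids `R(G/H)_{W_G(H)} ⟶ W_G(R)(G/G)` induced by the norm. -/
def coinvariantsNorm (g : G) (hg : ∀ a : G, a ∈ Subgroup.zpowers g) (H : Subgroup G) :
    R.Coinvariants H →* (R.witt g).obj (orbit ⊤) where
  toFun := Quotient.lift (R.nmWitt g H) fun r s h => by
    have h' := (Submodule.quotientRel_def _).1 h
    rw [← R.nmWitt_add g hg H s h', add_sub_cancel]
  map_one' := map_one (R.nmWitt g H)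
  map_mul' c d := by
    obtain ⟨c, rfl⟩ := Ideal.Quotient.mk_surjective c
    obtain ⟨d, rfl⟩ := Ideal.Quotient.mk_surjective d
    exact map_mul (R.nmWitt g H) c d

theorem coinvariantsNorm_toCoinvariants (g : G) (hg : ∀ a : G, a ∈ Subgroup.zpowers g)
    (H : Subgroup G) (r : R.obj (orbit H)) :
    R.coinvariantsNorm g hg H (R.toCoinvariants H r) =
      R.toWitt g (orbit ⊤) (R.nm (orbitMap le_top) r) := rfl

/-! ### Restriction of the norm -/

/-- Multiplication by an element of the abelian group `G/H`, as a section of the second projection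
of `G/H × G/H`. -/
def orbitShear (H : Subgroup G) (c : G ⧸ H) : orbit H →[G] prod (orbit H) (orbit H) where
  toFun x := ((c * (show G ⧸ H from x) : G ⧸ H), x)
  map_smul' b x := by
    induction x using QuotientGroup.induction_on with
    | H x =>
      induction c using QuotientGroup.induction_on with
      | H c => exact Prod.ext (congrArg QuotientGroup.mk (mul_left_comm c b x)) rfl

/-- The double coset formula for the restriction of a norm. -/
theorem res_nm_orbitMap (H : Subgroup G) [Fintype (G ⧸ H)] (r : R.obj (orbit H)) :
    R.res (orbitMap le_top) (R.nm (orbitMap (le_top : H ≤ ⊤)) r) =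
      ∏ c : G ⧸ H, R.act c.out (orbit H) r := by
  -- The shears are disjoint by cancellation in `G/H`, and `(z₁, z₂)` lies on the shear by `z₁ /
  -- z₂`.
  rw [R.res_nm _ _ _ _ (isPullbackSquare_prod (orbit H) (orbit H) _ _),
    R.nm_eq_prod (prodSnd (orbit H) (orbit H)) (orbitShear H) (fun _ _ => rfl)
      (fun c d x h => mul_right_cancel (G := G ⧸ H) (congrArg Prod.fst h))
      (fun z => ⟨(show G ⧸ H from z.1) / (show G ⧸ H from z.2),
        Prod.ext (div_mul_cancel (G := G ⧸ H) z.1 z.2) rfl⟩)]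
  -- The first projection after the shear by `c` is translation by any representative of `c`.
  refine Finset.prod_congr rfl fun c _ => ?_
  rw [← R.res_comp, GreenFunctor.act]
  congr 2
  ext x
  induction x using QuotientGroup.induction_on with
  | H x =>
    change c * (x : G ⧸ H) = ((c.out * x : G) : G ⧸ H)
    rw [QuotientGroup.mk_mul, QuotientGroup.out_eq']

theorem toWitt_act (g : G) (hg : ∀ a : G, a ∈ Subgroup.zpowers g) (H : Subgroup G) (a : G)
    (r : R.obj (orbit H)) :
    R.toWitt g (orbit H) (R.act a _ r) = R.toWitt g (orbit H) r :=
  Ideal.Quotient.eq.2 (R.coinvariantsIdeal_le g hg H (Ideal.subset_span ⟨a, r, rfl⟩))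

end

end TambaraFunctor

theorem mainTheorem6 {G : Type u} [CommGroup G] [Finite G]
    (g : G) (hg : ∀ a : G, a ∈ Subgroup.zpowers g) (H : Subgroup G) :
    ∃ t : ∀ R : TambaraFunctor.{u, w} G, R.Coinvariants H →* (R.witt g).obj (orbit ⊤),
      -- the composite `R(G/H) ⟶ R(G/H)_{W_G(H)} ⟶ W_G(R)(G/G)` is given by the external norm
      (∀ (R : TambaraFunctor.{u, w} G) (r : R.obj (orbit H)),
        t R (R.toCoinvariants H r) =
          R.toWitt g (orbit ⊤) (R.ofExternalNorm H (orbit ⊤) (R.toExternalNorm H r))) ∧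
      -- naturality in the Tambara functor
      (∀ (R S : TambaraFunctor.{u, w} G) (φ : R.Hom S) (c : R.Coinvariants H),
        t S (φ.mapCoinvariants H c) = φ.mapWitt g (orbit ⊤) (t R c)) ∧
      -- the restriction to `G/H` is the `|G/H|`-th power map
      (∀ (R : TambaraFunctor.{u, w} G) (r : R.obj (orbit H)),
        (R.witt g).res (orbitMap le_top) (t R (R.toCoinvariants H r)) =
          R.coinvariantsToWitt g hg H (R.toCoinvariants H r ^ Nat.card (G ⧸ H))) := by
  refine ⟨fun R => R.coinvariantsNorm g hg H, fun R r => ?_, fun R S φ c => ?_, fun R r => ?_⟩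
  · rw [R.coinvariantsNorm_toCoinvariants, R.ofExternalNorm_toExternalNorm]
  · obtain ⟨r, rfl⟩ := Ideal.Quotient.mk_surjective c
    exact congrArg (S.toWitt g (orbit ⊤)) (φ.app_nm (orbitMap le_top) r).symm
  · have := Fintype.ofFinite (G ⧸ H)
    have h := congrArg (R.toWitt g (orbit H)) (R.res_nm_orbitMap H r)
    -- In the Witt vectors every translate of `r` has the class of `r`, so the product becomes a
    -- power.
    rw [map_prod, Finset.prod_congr rfl fun c _ => R.toWitt_act g hg H c.out r,
      Finset.prod_const, Finset.card_univ, ← Nat.card_eq_fintype_card] at h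
    refine h.trans ?_
    rw [← map_pow, ← map_pow]
    rfl
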